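/- For $\varepsilon\in[0,\tfrac12)$ put $C_\varepsilon=\tfrac12\bigl(1-2\sqrt{\varepsilon(1-\varepsilon)}\bigr)$. Let $\Gamma$ be a finite set. A nonadaptive quantum algorithm making $T$ queries to a black box $x:\Gamma\to\{0,1\}$ acts on the finite-dimensional Hilbert space with orthonormal basis $|i_1,\dots,i_T\rangle|\varphi_1,\dots,\varphi_T\rangle|\psi\rangle$, where $i_k\in\Gamma$, $\varphi_k\in\{0,1\}$ and $\psi$ ranges over a finite workspace of arbitrary size. It is given by two unitary operators $U,V$; on input $x$ it computes $V\,O_x^T\,U|0\rangle$, where $|0\rangle$ is a fixed basis state and $$O_x^T|i_1,\dots,i_T\rangle|\varphi_1,\dots,\varphi_T\rangle|\psi\rangle=|i_1,\dots,i_T\rangle|\varphi_1\oplus x(i_1),\dots,\varphi_T\oplus x(i_T)\rangle|\psi\rangle,$$ then measures in this basis, and its output is a function of the measurement outcome. For a function $F$ on $\{0,1\}^\Gamma$, let $Q^{na}_{2,\varepsilon}(F)$ be the smallest $T$ for which some such algorithm outputs $F(x)$ with probability of error at most $\varepsilon$ for every $x\in\{0,1\}^\Gamma$. An undirected loopless graph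 $G_x$ on the vertex set $\{1,\dots,n\}$ is given by its adjacency matrix, that is, by the black box $x:\{(i,j):1\le j<i\le n\}\to\{0,1\}$ with $x(i,j)=1$ if and only if $ij$ is an edge of $G_x$. Let $\mathrm{Connectivity}$ be the Boolean function that decides whether $G_x$ is connected. **Theorem.** For every $n$ and every $\varepsilon\in[0,\tfrac12)$, $$Q^{na}_{2,\varepsilon}(\mathrm{Connectivity})\ \ge\ C_\varepsilon\,\frac{n(n-1)}{8}.$$ -/

import Mathlib

open scoped ENNReal

noncomputable section

namespace NonadaptiveQuantum

/-! ### Nonadaptive quantum query algorithms on Boolean black boxes `x : Γ → Bool` -/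

/-- Labels of the computational basis states `|i₁, …, i_T⟩ |φ₁, …, φ_T⟩ |ψ⟩`: `T` query indices
in `Γ`, `T` answer bits, and a workspace of finite dimension `d`. -/
abbrev BasisLabel (Γ : Type) (T d : ℕ) : Type :=
  (Fin T → Γ) × (Fin T → Bool) × Fin d

/-- The finite-dimensional Hilbert space spanned by the basis states. -/
abbrev StateSpace (Γ : Type) (T d : ℕ) : Type :=
  EuclideanSpace ℂ (BasisLabel Γ T d)

/-- The permutation of the basis labels
`(i₁, …, i_T; φ₁, …, φ_T; ψ) ↦ (i₁, …, i_T; φ₁ ⊕ x(i₁), …, φ_T ⊕ x(i_T); ψ)`. -/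
def oraclePerm {Γ : Type} (T d : ℕ) (x : Γ → Bool) :
    Equiv.Perm (BasisLabel Γ T d) where
  toFun b := (b.1, fun k => xor (b.2.1 k) (x (b.1 k)), b.2.2)
  invFun b := (b.1, fun k => xor (b.2.1 k) (x (b.1 k)), b.2.2)
  left_inv b := by simp
  right_inv b := by simp

/-- The unitary operator `O_x^T`, which performs all `T` queries at once. -/
def oracle {Γ : Type} [Fintype Γ] (T d : ℕ) (x : Γ → Bool) :
    StateSpace Γ T d ≃ₗᵢ[ℂ] StateSpace Γ T d :=
  LinearIsometryEquiv.piLpCongrLeft 2 ℂ ℂ (oraclePerm T d x)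

/-- `O_x^T |I⟩|φ⟩|ψ⟩ = |I⟩|φ ⊕ x(I)⟩|ψ⟩` on the computational basis. -/
theorem oracle_single {Γ : Type} [Fintype Γ] [DecidableEq Γ] (T d : ℕ) (x : Γ → Bool)
    (I : Fin T → Γ) (φ : Fin T → Bool) (ψ : Fin d) :
    oracle T d x (EuclideanSpace.single (I, φ, ψ) 1) =
      EuclideanSpace.single (I, fun k => xor (φ k) (x (I k)), ψ) 1 :=
  EuclideanSpace.piLpCongrLeft_single (oraclePerm T d x) (I, φ, ψ) 1

/-- A nonadaptive quantum algorithm with `T` queries to a black box `Γ → Bool` and outputs in `R`: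
a pair `(U, V)` of unitary operators, the basis state in which the computation starts, and the
output attached to each outcome of the final measurement in the computational basis. (Measuring
only some of the registers is the case where `output` depends only on those.) -/
structure NonadaptiveAlgorithm (Γ R : Type) [Fintype Γ] (T : ℕ) where
  workDim : ℕ
  start : BasisLabel Γ T workDim
  U : StateSpace Γ T workDim ≃ₗᵢ[ℂ] StateSpace Γ T workDim
  V : StateSpace Γ T workDim ≃ₗᵢ[ℂ] StateSpace Γ T workDim
  output : BasisLabel Γ T workDim → R

namespace NonadaptiveAlgorithm

variable {Γ R : Type} [Fintype Γ] {T : ℕ}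

open scoped Classical in
/-- The final state `V O_x^T U |start⟩`. -/
def finalState (A : NonadaptiveAlgorithm Γ R T) (x : Γ → Bool) : StateSpace Γ T A.workDim :=
  A.V (oracle T A.workDim x (A.U (EuclideanSpace.single A.start 1)))

open scoped Classical in
/-- The probability that the output of `A` on the black box `x` is different from `r`. -/
def probNe (A : NonadaptiveAlgorithm Γ R T) (x : Γ → Bool) (r : R) : ℝ :=
  ∑ b : BasisLabel Γ T A.workDim, if A.output b ≠ r then ‖A.finalState x b‖ ^ 2 else 0

/-- `A` computes `F` with probability of error at most `ε` on every black box. -/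
def Computes (A : NonadaptiveAlgorithm Γ R T) (F : (Γ → Bool) → R) (ε : ℝ) : Prop :=
  ∀ x : Γ → Bool, A.probNe x (F x) ≤ ε

end NonadaptiveAlgorithm

/-- The nonadaptive quantum query complexity `Q^na_{2,ε}(F)`: the smallest `T` such that some
nonadaptive quantum algorithm with `T` queries computes `F` with probability of error at most `ε`
(it would be `⊤` if there were no such algorithm). -/
def queryComplexity {Γ R : Type} [Fintype Γ] (F : (Γ → Bool) → R) (ε : ℝ) : ℕ∞ :=
  sInf {q : ℕ∞ | ∃ T : ℕ, q = T ∧ ∃ A : NonadaptiveAlgorithm Γ R T, A.Computes F ε}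

/-- The constant `C_ε = (1 - 2 √(ε (1 - ε))) / 2`. -/
def errorConst (ε : ℝ) : ℝ := (1 - 2 * Real.sqrt (ε * (1 - ε))) / 2

/-! ### Graph connectivity in the adjacency matrix model -/

/-- The `n (n - 1) / 2` positions `(i, j)` with `j < i` of an `n × n` adjacency matrix. -/
abbrev Entry (n : ℕ) : Type := {p : Fin n × Fin n // p.2 < p.1}

/-- The graph `G_x`: for `j < i`, the vertices `i` and `j` are adjacent iff `x (i, j) = 1`. -/
def graphOf {n : ℕ} (x : Entry n → Bool) : SimpleGraph (Fin n) where
  Adj u v := (∃ h : v < u, x ⟨(u, v), h⟩ = true) ∨ (∃ h : u < v, x ⟨(v, u), h⟩ = true)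
  symm := ⟨fun _ _ h => h.symm⟩
  loopless := ⟨fun _ h => h.elim (fun ⟨h', _⟩ => lt_irrefl _ h') (fun ⟨h', _⟩ => lt_irrefl _ h')⟩

open scoped Classical in
/-- The Boolean function that decides whether `G_x` is connected. -/
def connectivity (n : ℕ) (x : Entry n → Bool) : Bool :=
  decide (graphOf x).Connected

end NonadaptiveQuantum

end

namespace NonadaptiveQuantum

/-! The queries are all made in the single state `U |start⟩`, which does not depend on the input. If
flipping bit `e` changes the function value at some input, the two final states must be nearly
orthogonal (`re_inner_finalState_le`), yet their inner product is at least `1 - 2w`, with `w` the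
probability of querying `e` (`one_sub_queryWeight_le_inner`). Hence `w ≥ C_ε`. These probabilities
sum to at most `T`, and every edge is pivotal for connectivity (a star, with or without that edge),
so `T ≥ C_ε n(n-1)/2`, four times the stated bound. -/

/-- If `a, b ≤ ε ≤ 1/2`, then `sin (α + β) ≤ sin (2θ)` for `sin² α = a`, `sin² β = b`,
`sin² θ = ε`, in algebraic form. -/
theorem sqrt_mul_add_sqrt_mul_le {a b ε : ℝ} (ha : 0 ≤ a) (hb : 0 ≤ b) (haε : a ≤ ε) (hbε : b ≤ ε)
    (hε : ε ≤ 1 / 2) :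
    √a * √(1 - b) + √(1 - a) * √b ≤ 2 * √(ε * (1 - ε)) := by
  have h1 : √(1 - ε) ≤ √(1 - a) := Real.sqrt_le_sqrt (by linarith)
  have h2 : √(1 - ε) ≤ √(1 - b) := Real.sqrt_le_sqrt (by linarith)
  have h3 : √a ≤ √ε := Real.sqrt_le_sqrt haε
  have h4 : √b ≤ √ε := Real.sqrt_le_sqrt hbε
  have h5 : √(1 - ε) * √(1 - ε) ≤ √(1 - a) * √(1 - b) := by gcongr
  have h6 : √a * √b ≤ √ε * √ε := by gcongr
  rw [Real.mul_self_sqrt (by linarith)] at h5 h6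
  have ea : √a ^ 2 = a := Real.sq_sqrt ha
  have eb : √b ^ 2 = b := Real.sq_sqrt hb
  have ea' : √(1 - a) ^ 2 = 1 - a := Real.sq_sqrt (by linarith)
  have eb' : √(1 - b) ^ 2 = 1 - b := Real.sq_sqrt (by linarith)
  have hs : √(ε * (1 - ε)) ^ 2 = ε * (1 - ε) :=
    Real.sq_sqrt (mul_nonneg (by linarith) (by linarith))
  -- Here `cos (α + β) ≥ (1 - ε) - ε = cos 2θ ≥ 0`; then `sin² + cos² = 1` turns this into the bound
  -- on the sine.
  have hc : (1 - 2 * ε) ^ 2 ≤ (√(1 - a) * √(1 - b) - √a * √b) ^ 2 :=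
    pow_le_pow_left₀ (by linarith) (by linarith) 2
  have hid : (√a * √(1 - b) + √(1 - a) * √b) ^ 2 +
      (√(1 - a) * √(1 - b) - √a * √b) ^ 2 = 1 := by
    calc _ = (√a ^ 2 + √(1 - a) ^ 2) * (√b ^ 2 + √(1 - b) ^ 2) := by ring
      _ = 1 := by rw [ea, eb, ea', eb']; ring
  refine (sq_le_sq₀ (by positivity) (by positivity)).1 ?_
  rw [mul_pow, hs]
  linarith

/-- Two unit vectors that are nearly supported on complementary sets have a small inner product. -/
theorem sum_mul_le_of_nearly_disjoint {ι : Type*} [Fintype ι] (p : ι → Prop) [DecidablePred p]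
    (f g : ι → ℝ) {ε : ℝ} (hε : ε ≤ 1 / 2) (hf : ∑ i, f i ^ 2 = 1) (hg : ∑ i, g i ^ 2 = 1)
    (hfp : ∑ i with p i, f i ^ 2 ≤ ε) (hgp : ∑ i with ¬ p i, g i ^ 2 ≤ ε) :
    ∑ i, f i * g i ≤ 2 * √(ε * (1 - ε)) := by
  rw [← Finset.sum_filter_add_sum_filter_not _ p] at hf hg ⊢
  refine le_trans (add_le_add (Real.sum_mul_le_sqrt_mul_sqrt _ f g)
    (Real.sum_mul_le_sqrt_mul_sqrt _ f g)) ?_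
  rw [eq_sub_of_add_eq hg, eq_sub_of_add_eq' hf]
  exact sqrt_mul_add_sqrt_mul_le (Finset.sum_nonneg fun _ _ => sq_nonneg _)
    (Finset.sum_nonneg fun _ _ => sq_nonneg _) hfp hgp hε

section Oracle

variable {Γ : Type} [Fintype Γ] {T d : ℕ}

theorem oracle_apply (x : Γ → Bool) (v : StateSpace Γ T d) (b : BasisLabel Γ T d) :
    oracle T d x v b = v (oraclePerm T d x b) := rfl

open scoped Classical in
/-- The probability that the query indices of a basis state measured in the state `v` contain
`e`. -/
noncomputable def queryWeight (v : StateSpace Γ T d) (e : Γ) : ℝ :=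
  ∑ b : BasisLabel Γ T d, if ∃ k, b.1 k = e then ‖v b‖ ^ 2 else 0

/-- The oracle permutes basis labels and fixes their index registers. -/
theorem queryWeight_oracle (x : Γ → Bool) (v : StateSpace Γ T d) (e : Γ) :
    queryWeight (oracle T d x v) e = queryWeight v e :=
  Equiv.sum_comp (oraclePerm T d x)
    (fun b => open scoped Classical in if ∃ k, b.1 k = e then ‖v b‖ ^ 2 else 0)

theorem sum_norm_sq_eq_one {ι : Type*} [Fintype ι] {v : EuclideanSpace ℂ ι} (hv : ‖v‖ = 1) :
    ∑ b, ‖v b‖ ^ 2 = 1 := by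
  rw [← EuclideanSpace.norm_sq_eq, hv, one_pow]

/-- A label contains at most `T` distinct indices, so its probability is counted at most `T` times.
-/
theorem sum_queryWeight_le {v : StateSpace Γ T d} (hv : ‖v‖ = 1) :
    ∑ e, queryWeight v e ≤ T := by
  classical
  have h (b : BasisLabel Γ T d) :
      ∑ e, (if ∃ k, b.1 k = e then ‖v b‖ ^ 2 else 0) ≤ T * ‖v b‖ ^ 2 := by
    rw [← Finset.sum_filter, Finset.sum_const, nsmul_eq_mul]
    gcongr
    calc _ = (Finset.univ.image b.1).card := by congr 1; ext; simp
      _ ≤ T := Finset.card_image_le.trans_eq (Finset.card_fin T)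
  calc ∑ e, queryWeight v e
      = ∑ b : BasisLabel Γ T d, ∑ e, (if ∃ k, b.1 k = e then ‖v b‖ ^ 2 else 0) := by
        rw [Finset.sum_comm]
        refine Finset.sum_congr rfl fun e _ => Finset.sum_congr rfl fun b _ => ?_
        congr
    _ ≤ ∑ b : BasisLabel Γ T d, T * ‖v b‖ ^ 2 := Finset.sum_le_sum fun b _ => h b
    _ = T := by rw [← Finset.mul_sum, sum_norm_sq_eq_one hv, mul_one]

/-- If `x` and `y` differ only at `e`, then `O_x v` and `O_y v` can be distinguished only by means
of the part of `v` that queries `e`. -/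
theorem one_sub_queryWeight_le_inner {x y : Γ → Bool} {e : Γ} (hxy : ∀ i, i ≠ e → x i = y i)
    {v : StateSpace Γ T d} (hv : ‖v‖ = 1) :
    1 - 2 * queryWeight v e ≤ (inner ℂ (oracle T d x v) (oracle T d y v)).re := by
  classical
  set u := oracle T d x v with hu
  set w := oracle T d y v with hw
  -- Termwise: labels avoiding `e` have `u b = w b`; on the others Cauchy–Schwarz loses at most
  -- twice the mean of the two squared norms.
  have hsum : ∑ b, (‖u b‖ ^ 2 / 2 + ‖w b‖ ^ 2 / 2) -
      (queryWeight u e + queryWeight w e) ≤ (inner ℂ u w).re := by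
    rw [PiLp.inner_apply, Complex.re_sum, queryWeight, queryWeight, ← Finset.sum_add_distrib,
      ← Finset.sum_sub_distrib]
    refine Finset.sum_le_sum fun b _ => ?_
    by_cases hb : ∃ k, b.1 k = e
    · rw [if_pos hb, if_pos hb]
      have h1 : -(inner ℂ (u b) (w b)).re ≤ ‖u b‖ * ‖w b‖ :=
        (neg_le_abs _).trans ((Complex.abs_re_le_norm _).trans (norm_inner_le_norm _ _))
      nlinarith [sq_nonneg (‖u b‖ - ‖w b‖)]
    · rw [if_neg hb, if_neg hb]
      have heq : w b = u b := by
        have : oraclePerm T d y b = oraclePerm T d x b := by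
          have : ∀ k, x (b.1 k) = y (b.1 k) := fun k => hxy _ fun h => hb ⟨k, h⟩
          simp [oraclePerm, this]
        rw [hu, hw, oracle_apply, oracle_apply, this]
      have h2 : (inner ℂ (u b) (u b)).re = ‖u b‖ ^ 2 := inner_self_eq_norm_sq (𝕜 := ℂ) (u b)
      rw [heq, h2]
      linarith
  rw [queryWeight_oracle, queryWeight_oracle, Finset.sum_add_distrib, ← Finset.sum_div,
    ← Finset.sum_div, sum_norm_sq_eq_one (by rw [hu, LinearIsometryEquiv.norm_map, hv]),
    sum_norm_sq_eq_one (by rw [hw, LinearIsometryEquiv.norm_map, hv])] at hsum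
  linarith

end Oracle

namespace NonadaptiveAlgorithm

variable {Γ : Type} [Fintype Γ] {T : ℕ}

open scoped Classical in
/-- The state `U |start⟩` in which the queries are made. -/
noncomputable def queryState {R : Type} (A : NonadaptiveAlgorithm Γ R T) : StateSpace Γ T A.workDim :=
  A.U (EuclideanSpace.single A.start 1)

theorem norm_queryState {R : Type} (A : NonadaptiveAlgorithm Γ R T) : ‖A.queryState‖ = 1 := by
  simp [queryState]

theorem finalState_eq {R : Type} (A : NonadaptiveAlgorithm Γ R T) (x : Γ → Bool) :
    A.finalState x = A.V (oracle T A.workDim x A.queryState) := rfl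

theorem norm_finalState {R : Type} (A : NonadaptiveAlgorithm Γ R T) (x : Γ → Bool) :
    ‖A.finalState x‖ = 1 := by
  rw [finalState_eq, LinearIsometryEquiv.norm_map, LinearIsometryEquiv.norm_map, norm_queryState]

/-- Final states on inputs with different function values are nearly orthogonal. -/
theorem re_inner_finalState_le {A : NonadaptiveAlgorithm Γ Bool T} {F : (Γ → Bool) → Bool}
    {ε : ℝ} (hA : A.Computes F ε) (hε : ε ≤ 1 / 2) {x y : Γ → Bool} (hxy : F x ≠ F y) :
    (inner ℂ (A.finalState x) (A.finalState y)).re ≤ 2 * √(ε * (1 - ε)) := by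
  classical
  refine le_trans ?_ (sum_mul_le_of_nearly_disjoint (fun b => A.output b ≠ F x)
    (fun b => ‖A.finalState x b‖) (fun b => ‖A.finalState y b‖) hε
    (sum_norm_sq_eq_one (A.norm_finalState x)) (sum_norm_sq_eq_one (A.norm_finalState y)) ?_ ?_)
  · rw [PiLp.inner_apply, Complex.re_sum]
    exact Finset.sum_le_sum fun b _ =>
      (Complex.re_le_norm _).trans (norm_inner_le_norm _ _)
  · rw [Finset.sum_filter]
    refine le_of_eq_of_le (Finset.sum_congr rfl fun b _ => ?_) (hA x)
    congr
  · rw [Finset.sum_filter]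
    refine le_of_eq_of_le (Finset.sum_congr rfl fun b _ => ?_) (hA y)
    -- With Boolean values, being right for `x` is the same as being wrong for `y`.
    have : ¬ A.output b ≠ F x ↔ A.output b ≠ F y := by
      revert hxy
      cases A.output b <;> cases F x <;> cases F y <;> simp
    simp only [this]

/-- A position at which some change of a single bit changes `F` is queried with probability at
least `C_ε`. -/
theorem errorConst_le_queryWeight {A : NonadaptiveAlgorithm Γ Bool T} {F : (Γ → Bool) → Bool}
    {ε : ℝ} (hA : A.Computes F ε) (hε : ε ≤ 1 / 2) {x y : Γ → Bool} {e : Γ}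
    (he : ∀ i, i ≠ e → x i = y i) (hxy : F x ≠ F y) :
    errorConst ε ≤ queryWeight A.queryState e := by
  have h1 := one_sub_queryWeight_le_inner he A.norm_queryState
  have h2 := re_inner_finalState_le hA hε hxy
  rw [finalState_eq, finalState_eq, LinearIsometryEquiv.inner_map_map] at h2
  rw [errorConst]
  linarith

/-- If every position is pivotal for `F` at some input, then computing `F` nonadaptively takes at
least `C_ε |Γ|` queries. -/
theorem errorConst_mul_card_le {A : NonadaptiveAlgorithm Γ Bool T} {F : (Γ → Bool) → Bool}
    {ε : ℝ} (hA : A.Computes F ε) (hε : ε ≤ 1 / 2)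
    (hF : ∀ e, ∃ x y : Γ → Bool, (∀ i, i ≠ e → x i = y i) ∧ F x ≠ F y) :
    errorConst ε * Fintype.card Γ ≤ T := by
  refine le_trans ?_ (sum_queryWeight_le A.norm_queryState)
  rw [mul_comm, ← nsmul_eq_mul]
  refine Finset.card_nsmul_le_sum _ _ _ fun e _ => ?_
  obtain ⟨x, y, he, hxy⟩ := hF e
  exact errorConst_le_queryWeight hA hε he hxy

end NonadaptiveAlgorithm

theorem errorConst_nonneg {ε : ℝ} : 0 ≤ errorConst ε := by
  have : √(ε * (1 - ε)) ≤ 1 / 2 :=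
    Real.sqrt_le_iff.2 ⟨by norm_num, by nlinarith [sq_nonneg (2 * ε - 1)]⟩
  rw [errorConst]
  linarith

theorem card_entry_mul_two (n : ℕ) : Fintype.card (Entry n) * 2 = n * (n - 1) := by
  have : Fintype.card (Entry n) = ∑ i ∈ Finset.range n, i := by
    rw [Fintype.card_subtype, ← Fin.sum_univ_eq_sum_range, Finset.card_filter,
      Fintype.sum_prod_type]
    refine Finset.sum_congr rfl fun i _ => ?_
    rw [← Finset.card_filter]
    exact (congrArg Finset.card (by ext; simp)).trans (Fin.card_Iio i)
  rw [this, Finset.sum_range_id_mul_two]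

/-- Deleting an edge `ij` from the star centred at `i` disconnects it. -/
theorem exists_pivotal_connectivity (n : ℕ) (e : Entry n) :
    ∃ x y : Entry n → Bool, (∀ p, p ≠ e → x p = y p) ∧ connectivity n x ≠ connectivity n y := by
  classical
  obtain ⟨⟨i, j⟩, hij⟩ := e
  dsimp only at hij
  refine ⟨fun p => decide (p.1.1 = i ∨ p.1.2 = i),
    fun p => decide ((p.1.1 = i ∨ p.1.2 = i) ∧ p ≠ ⟨(i, j), hij⟩), fun p hp => by simp [hp], ?_⟩
  have h1 : connectivity n (fun p => decide (p.1.1 = i ∨ p.1.2 = i)) = true := by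
    rw [connectivity, decide_eq_true_iff, SimpleGraph.connected_iff_exists_forall_reachable]
    refine ⟨i, fun w => ?_⟩
    rcases lt_trichotomy w i with h | h | h
    · exact SimpleGraph.Adj.reachable (Or.inl ⟨h, by simp⟩)
    · rw [h]
    · exact SimpleGraph.Adj.reachable (Or.inr ⟨h, by simp⟩)
  have h2 : connectivity n
      (fun p => decide ((p.1.1 = i ∨ p.1.2 = i) ∧ p ≠ ⟨(i, j), hij⟩)) = false := by
    rw [connectivity, decide_eq_false_iff_not]
    intro hc
    have : Nontrivial (Fin n) := ⟨⟨i, j, hij.ne'⟩⟩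
    -- All edges meet `i` and `ij` is deleted, so `j` is isolated.
    obtain ⟨w, hw⟩ := hc.preconnected.exists_adj_of_nontrivial j
    rcases hw with ⟨h, hx⟩ | ⟨h, hx⟩
    · obtain ⟨h' | h', -⟩ := of_decide_eq_true hx
      · exact hij.ne h'
      · exact lt_asymm hij (h'.symm.trans_lt h)
    · obtain ⟨h' | h', hne⟩ := of_decide_eq_true hx
      · exact hne (Subtype.ext (Prod.ext h' rfl))
      · exact hij.ne h'
  rw [h1, h2]
  decide

end NonadaptiveQuantum

theorem mainTheorem5 (n : ℕ) (ε : ℝ) (hε : ε ∈ Set.Ico (0 : ℝ) (1 / 2)) :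
    ENNReal.ofReal (NonadaptiveQuantum.errorConst ε * ((n : ℝ) * ((n : ℝ) - 1)) / 8) ≤
      ((NonadaptiveQuantum.queryComplexity (NonadaptiveQuantum.connectivity n) ε : ℕ∞) :
        ENNReal) := by
  open NonadaptiveQuantum in
  rcases Set.eq_empty_or_nonempty {q : ℕ∞ | ∃ T : ℕ, q = T ∧
    ∃ A : NonadaptiveAlgorithm (Entry n) Bool T, A.Computes (connectivity n) ε} with h | h
  · rw [queryComplexity, h, sInf_empty]
    exact le_top
  · obtain ⟨T, hT, A, hA⟩ := csInf_mem h
    rw [queryComplexity, hT, ENat.toENNReal_coe]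
    refine ENNReal.ofReal_le_of_le_toReal ?_
    rw [ENNReal.toReal_natCast]
    have h1 := NonadaptiveAlgorithm.errorConst_mul_card_le hA hε.2.le
      (exists_pivotal_connectivity n)
    have h2 : (Fintype.card (Entry n) : ℝ) * 2 = n * (n - 1) := by
      have := card_entry_mul_two n
      -- The case `n = 0` is separate because `n - 1` truncates in `ℕ`.
      rcases n with _ | m
      · simp
      · rw [Nat.add_sub_cancel] at this
        rw [Nat.cast_succ, add_sub_cancel_right]
        exact_mod_cast this
    -- Nonnegativity allows `h1` to be weakened by the factor 4.
    have h3 : 0 ≤ errorConst ε * Fintype.card (Entry n) :=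
      mul_nonneg errorConst_nonneg (Nat.cast_nonneg _)
    rw [← h2]
    linarith
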